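/- Let $n\ge 0$ and let $\mathcal M_n$ denote the algebra of complex $n\times n$ matrices, with identity matrix $1$ and conjugate transpose $A\mapsto A^\dagger$. Let $\mathcal E:\mathcal M_n\to\mathcal M_n$ be a positive linear map, i.e. a linear map sending positive semidefinite matrices to positive semidefinite matrices, and let $\mathcal E^*$ denote its adjoint for the Hilbert–Schmidt inner product $\langle A,B\rangle=\operatorname{tr}(A^\dagger B)$. Put $$\operatorname{DS}(\mathcal E):=\operatorname{tr}\big((\mathcal E(1)-1)^2\big)+\operatorname{tr}\big((\mathcal E^*(1)-1)^2\big).$$ For $\varepsilon>0$, call $\mathcal E$ $\varepsilon$-scalable if there exist $X,Y\in\mathcal M_n$ such that the map $\mathcal E'(A):=Y^\dagger\,\mathcal E(XAX^\dagger)\,Y$ satisfies $\operatorname{DS}(\mathcal E')\le\varepsilon^2$. Call $\mathcal E$ approximately scalable (to doubly stochastic maps) if it is $\varepsilon$-scalable for every $\varepsilon>0$, and rank non-decreasing if $\operatorname{rank}\mathcal E(A)\ge\operatorname{rank}A$ for every positive semidefinite $A\in\mathcal M_n$. Theorem (Approximate Operator Sinkhorn Theorem). A positive linear map $\mathcal E:\mathcal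 M_n\to\mathcal M_n$ is approximately scalable if and only if it is rank non-decreasing. -/

import Mathlib

open scoped Matrix MatrixOrder ComplexOrder

namespace OperatorScaling

/-- The algebra of complex `n × n` matrices. With `MatrixOrder` open, `0 ≤ A` means that `A` is
positive semidefinite, so `M n →ₚ[ℂ] M n` is the type of positive linear maps. -/
abbrev M (n : ℕ) : Type := Matrix (Fin n) (Fin n) ℂ

/-- A positive linear map is one that sends positive semidefinite matrices to positive
semidefinite matrices. -/
theorem posSemidef_map {n : ℕ} (E : M n →ₚ[ℂ] M n) {A : M n} (hA : A.PosSemidef) :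
    (E A).PosSemidef :=
  Matrix.nonneg_iff_posSemidef.mp (map_nonneg E (Matrix.nonneg_iff_posSemidef.mpr hA))

/-- Every linear map preserving positive semidefiniteness is a positive linear map. -/
noncomputable def ofPosSemidef {n : ℕ} (f : M n →ₗ[ℂ] M n)
    (hf : ∀ A : M n, A.PosSemidef → (f A).PosSemidef) : M n →ₚ[ℂ] M n :=
  PositiveLinearMap.mk₀ f fun A hA =>
    Matrix.nonneg_iff_posSemidef.mpr (hf A (Matrix.nonneg_iff_posSemidef.mp hA))

/-- The scaling `A ↦ Yᴴ * E (X * A * Xᴴ) * Y` of a positive map `E`, again a positive map. -/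
noncomputable def scaling {n : ℕ} (X Y : M n) (E : M n →ₚ[ℂ] M n) : M n →ₚ[ℂ] M n :=
  ofPosSemidef
    { toFun := fun A => Yᴴ * E (X * A * Xᴴ) * Y
      map_add' := fun A B => by simp only [mul_add, add_mul, map_add]
      map_smul' := fun c A => by
        simp only [Matrix.mul_smul, Matrix.smul_mul, map_smul, RingHom.id_apply] }
    fun _ hA => (posSemidef_map E (hA.mul_mul_conjTranspose_same X)).conjTranspose_mul_mul_same Y

theorem scaling_apply {n : ℕ} (X Y : M n) (E : M n →ₚ[ℂ] M n) (A : M n) :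
    scaling X Y E A = Yᴴ * E (X * A * Xᴴ) * Y := rfl

/-- The adjoint `E*` of `E` for the Hilbert–Schmidt inner product `⟨A, B⟩ = tr (Aᴴ B)`; its
`(i, j)` entry at `B` is `⟨E (e_ij), B⟩`, where `e_ij` is the matrix unit. -/
noncomputable def adjointMap {n : ℕ} (E : M n →ₚ[ℂ] M n) (B : M n) : M n :=
  Matrix.of fun i j => ((E (Matrix.single i j 1))ᴴ * B).trace

/-- The defining property `⟨A, E* B⟩ = ⟨E A, B⟩` of the Hilbert–Schmidt adjoint. -/
theorem trace_adjointMap {n : ℕ} (E : M n →ₚ[ℂ] M n) (A B : M n) :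
    (Aᴴ * adjointMap E B).trace = ((E A)ᴴ * B).trace := by
  have h : E A = ∑ i, ∑ j, A i j • E (Matrix.single i j 1) := by
    conv_lhs => rw [Matrix.matrix_eq_sum_single A]
    simp only [map_sum]
    refine Finset.sum_congr rfl fun i _ => Finset.sum_congr rfl fun j _ => ?_
    rw [← map_smul, Matrix.smul_single, smul_eq_mul, mul_one]
  rw [h]
  simp only [Matrix.conjTranspose_sum, Matrix.conjTranspose_smul, Finset.sum_mul,
    Matrix.trace_sum, Matrix.smul_mul, Matrix.trace_smul, smul_eq_mul]
  rw [Finset.sum_comm]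
  simp [Matrix.trace, Matrix.mul_apply, adjointMap]

/-- The error `DS E = tr ((E(1) - 1)²) + tr ((E*(1) - 1)²)`. Both traces are real, since
`E(1)` and `E*(1)` are Hermitian; see `DS_eq`. -/
noncomputable def DS {n : ℕ} (E : M n →ₚ[ℂ] M n) : ℝ :=
  (((E 1 - 1) ^ 2).trace + ((adjointMap E 1 - 1) ^ 2).trace).re

/-- Taking real parts in the definition of `DS` loses nothing. -/
theorem DS_eq {n : ℕ} (E : M n →ₚ[ℂ] M n) :
    (DS E : ℂ) = ((E 1 - 1) ^ 2).trace + ((adjointMap E 1 - 1) ^ 2).trace := by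
  have key : ∀ B : M n, B.IsHermitian → (starRingEnd ℂ) (((B - 1) ^ 2).trace)
      = ((B - 1) ^ 2).trace := fun B hB => by
    have h : ((B - 1) ^ 2)ᴴ = (B - 1) ^ 2 := by
      rw [Matrix.conjTranspose_pow, Matrix.conjTranspose_sub, Matrix.conjTranspose_one, hB.eq]
    conv_rhs => rw [← h, Matrix.trace_conjTranspose]
    rfl
  have hs : ∀ A : M n, E Aᴴ = (E A)ᴴ := fun A => map_star E A
  have h2 : (adjointMap E 1).IsHermitian := by
    ext i j
    simp only [adjointMap, Matrix.conjTranspose_apply, Matrix.of_apply, mul_one]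
    rw [← hs, ← hs, ← Matrix.trace_conjTranspose, ← hs]
    simp
  have h1 : (E 1).IsHermitian := by
    rw [Matrix.IsHermitian, ← hs, Matrix.conjTranspose_one]
  apply Complex.conj_eq_iff_re.mp
  rw [map_add, key _ h1, key _ h2]

/-- A positive map is `ε`-doubly stochastic if `DS E ≤ ε²`. -/
noncomputable def IsEpsDoublyStochastic {n : ℕ} (ε : ℝ) (E : M n →ₚ[ℂ] M n) : Prop :=
  DS E ≤ ε ^ 2

/-- A positive map is `ε`-scalable if one of its scalings is `ε`-doubly stochastic. -/
noncomputable def IsEpsScalable {n : ℕ} (ε : ℝ) (E : M n →ₚ[ℂ] M n) : Prop :=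
  ∃ X Y : M n, IsEpsDoublyStochastic ε (scaling X Y E)

/-- A positive map is approximately scalable if it is `ε`-scalable for every `ε > 0`. -/
noncomputable def IsApproxScalable {n : ℕ} (E : M n →ₚ[ℂ] M n) : Prop :=
  ∀ ε : ℝ, 0 < ε → IsEpsScalable ε E

/-- A positive map is rank non-decreasing if `rank (E A) ≥ rank A` for all positive
semidefinite `A`. -/
noncomputable def IsRankNonDecreasing {n : ℕ} (E : M n →ₚ[ℂ] M n) : Prop :=
  ∀ A : M n, A.PosSemidef → A.rank ≤ (E A).rank

end OperatorScaling

namespace OperatorScaling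

/-! Necessity. If `DS E` is small, all eigenvalues of `E 1` and `E*(1)` are close to 1. For a
projection P of rank r, tr E(P) = tr(P E*(1)) is nearly at least r, while E(P) ≤ E(1) gives tr E(P)
at most about rank E(P); integrality forces rank E(P) ≥ r (`rank_le_rank_map_of_DS_le`). Undoing the
scaling requires only that X be invertible (`isUnit_of_DS_scaling_le`).

Sufficiency is variational. The capacity inf det E(X) / det X over positive definite X is positive
(`IsRankNonDecreasing.exists_mul_det_le`): if P projects onto the top k+1 eigenvectors of X, with x
the least of their eigenvalues, then E(X) ≥ x E(P), and compactness of the unitary group bounds the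
(k+1)-st eigenvalue of E(P) away from 0. The infimum need not be attained. Rescaling at a
near-minimizer makes E unital with det E(A) ≥ exp(-δ) det A, and perturbing A = 1 against E*(1) - 1
shows that this forces `DS E` = O(nδ) (`DS_le_of_det_le`), so no iteration is needed. -/

/-- The matrix with orthonormal eigenbasis the columns of `U` and eigenvalues `d`. -/
noncomputable def unitaryDiag {n : ℕ} (U : M n) (d : Fin n → ℝ) : M n :=
  U * Matrix.diagonal (fun i => (d i : ℂ)) * Uᴴ

/-- The real part of the quadratic form of a matrix. -/
noncomputable def quadForm {n : ℕ} (A : M n) (v : Fin n → ℂ) : ℝ :=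
  (star v ⬝ᵥ A *ᵥ v).re

/-- The squared Euclidean norm. -/
noncomputable def normSq {n : ℕ} (v : Fin n → ℂ) : ℝ := ∑ i, ‖v i‖ ^ 2

/-! ### Unitary diagonalization and quadratic forms -/

theorem conjTranspose_mul_self_of_mem_unitaryGroup {n : ℕ} {U : M n}
    (hU : U ∈ Matrix.unitaryGroup (Fin n) ℂ) : Uᴴ * U = 1 :=
  Matrix.mem_unitaryGroup_iff'.mp hU

theorem mul_conjTranspose_self_of_mem_unitaryGroup {n : ℕ} {U : M n}
    (hU : U ∈ Matrix.unitaryGroup (Fin n) ℂ) : U * Uᴴ = 1 :=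
  Matrix.mem_unitaryGroup_iff.mp hU

theorem exists_eq_unitaryDiag {n : ℕ} {A : M n} (hA : A.IsHermitian) :
    ∃ U ∈ Matrix.unitaryGroup (Fin n) ℂ, ∃ d : Fin n → ℝ, Antitone d ∧ A = unitaryDiag U d := by
  -- Sorting the negated eigenvalues lists the eigenvalues in decreasing order, as the min-max
  -- argument needs.
  set σ := Tuple.sort (fun i => -hA.eigenvalues i) with hσ
  set W : M n := (hA.eigenvectorUnitary : M n) with hW
  have hWU : W ∈ Matrix.unitaryGroup (Fin n) ℂ := hA.eigenvectorUnitary.2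
  refine ⟨W.submatrix id σ, ?_, hA.eigenvalues ∘ σ, ?_, ?_⟩
  · rw [Matrix.mem_unitaryGroup_iff']
    have h := conjTranspose_mul_self_of_mem_unitaryGroup hWU
    rw [Matrix.star_eq_conjTranspose, Matrix.conjTranspose_submatrix,
      ← Matrix.submatrix_mul _ _ _ _ _ Function.bijective_id, h]
    exact Matrix.submatrix_one_equiv σ
  · intro i j hij
    have := Tuple.monotone_sort (fun i => -hA.eigenvalues i) hij
    simpa using this
  · have h := hA.spectral_theorem
    rw [Unitary.conjStarAlgAut_apply] at h
    rw [unitaryDiag, Matrix.conjTranspose_submatrix]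
    have h2 : Matrix.diagonal (fun i => (((hA.eigenvalues ∘ σ) i : ℝ) : ℂ)) =
        (Matrix.diagonal (RCLike.ofReal ∘ hA.eigenvalues) : M n).submatrix σ σ := by
      rw [Matrix.submatrix_diagonal_equiv]; rfl
    rw [h2, Matrix.submatrix_mul_equiv, Matrix.submatrix_mul_equiv]
    exact h

theorem normSq_nonneg {n : ℕ} (v : Fin n → ℂ) : 0 ≤ normSq v :=
  Finset.sum_nonneg fun _ _ => by positivity

theorem normSq_pos {n : ℕ} {v : Fin n → ℂ} (hv : v ≠ 0) : 0 < normSq v := by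
  obtain ⟨i, hi⟩ := Function.ne_iff.mp hv
  exact Finset.sum_pos' (fun _ _ => by positivity) ⟨i, Finset.mem_univ _, by
    have : 0 < ‖v i‖ := norm_pos_iff.mpr hi
    positivity⟩

theorem star_dotProduct_self {n : ℕ} (v : Fin n → ℂ) : star v ⬝ᵥ v = (normSq v : ℂ) := by
  simp only [dotProduct, normSq, Pi.star_apply, RCLike.star_def, Complex.conj_mul',
    Complex.ofReal_sum, Complex.ofReal_pow]

theorem normSq_conjTranspose_mulVec {n : ℕ} {U : M n} (hU : U ∈ Matrix.unitaryGroup (Fin n) ℂ)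
    (v : Fin n → ℂ) : normSq (Uᴴ *ᵥ v) = normSq v := by
  have h : star (Uᴴ *ᵥ v) ⬝ᵥ (Uᴴ *ᵥ v) = star v ⬝ᵥ v := by
    rw [Matrix.star_mulVec, Matrix.conjTranspose_conjTranspose, ← Matrix.dotProduct_mulVec,
      Matrix.mulVec_mulVec, mul_conjTranspose_self_of_mem_unitaryGroup hU, Matrix.one_mulVec]
  rw [star_dotProduct_self, star_dotProduct_self] at h
  exact_mod_cast h

theorem quadForm_unitaryDiag {n : ℕ} (U : M n) (d : Fin n → ℝ) (v : Fin n → ℂ) :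
    quadForm (unitaryDiag U d) v = ∑ i, d i * ‖(Uᴴ *ᵥ v) i‖ ^ 2 := by
  have h : star v ⬝ᵥ unitaryDiag U d *ᵥ v = star (Uᴴ *ᵥ v) ⬝ᵥ
      (Matrix.diagonal (fun i => (d i : ℂ))) *ᵥ (Uᴴ *ᵥ v) := by
    rw [Matrix.star_mulVec, Matrix.conjTranspose_conjTranspose, ← Matrix.dotProduct_mulVec,
      Matrix.mulVec_mulVec, Matrix.mulVec_mulVec, unitaryDiag, mul_assoc]
  have h2 : star v ⬝ᵥ unitaryDiag U d *ᵥ v =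
      ((∑ i, d i * ‖(Uᴴ *ᵥ v) i‖ ^ 2 : ℝ) : ℂ) := by
    rw [h, dotProduct]
    push_cast
    refine Finset.sum_congr rfl fun i _ => ?_
    rw [Matrix.mulVec_diagonal, Pi.star_apply, RCLike.star_def, ← Complex.conj_mul']
    ring
  rw [quadForm, h2, Complex.ofReal_re]

theorem quadForm_sub {n : ℕ} (A B : M n) (v : Fin n → ℂ) :
    quadForm (A - B) v = quadForm A v - quadForm B v := by
  simp [quadForm, Matrix.sub_mulVec, dotProduct_sub]

theorem quadForm_smul {n : ℕ} (c : ℝ) (A : M n) (v : Fin n → ℂ) :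
    quadForm ((c : ℂ) • A) v = c * quadForm A v := by
  simp [quadForm, Matrix.smul_mulVec, dotProduct_smul]

theorem quadForm_one {n : ℕ} (v : Fin n → ℂ) : quadForm 1 v = normSq v := by
  rw [quadForm, Matrix.one_mulVec, star_dotProduct_self, Complex.ofReal_re]

theorem quadForm_nonneg {n : ℕ} {A : M n} (hA : A.PosSemidef) (v : Fin n → ℂ) :
    0 ≤ quadForm A v :=
  hA.re_dotProduct_nonneg v

theorem det_unitaryDiag {n : ℕ} {U : M n} (hU : U ∈ Matrix.unitaryGroup (Fin n) ℂ)
    (d : Fin n → ℝ) : (unitaryDiag U d).det = ((∏ i, d i : ℝ) : ℂ) := by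
  rw [unitaryDiag, Matrix.det_mul_right_comm, mul_conjTranspose_self_of_mem_unitaryGroup hU,
    one_mul, Matrix.det_diagonal]
  push_cast
  rfl

theorem trace_unitaryDiag {n : ℕ} {U : M n} (hU : U ∈ Matrix.unitaryGroup (Fin n) ℂ)
    (d : Fin n → ℝ) : (unitaryDiag U d).trace = ((∑ i, d i : ℝ) : ℂ) := by
  rw [unitaryDiag, Matrix.trace_mul_comm, ← mul_assoc,
    conjTranspose_mul_self_of_mem_unitaryGroup hU, one_mul, Matrix.trace_diagonal]
  push_cast
  rfl

theorem unitaryDiag_mul {n : ℕ} {U : M n} (hU : U ∈ Matrix.unitaryGroup (Fin n) ℂ)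
    (d e : Fin n → ℝ) :
    unitaryDiag U d * unitaryDiag U e = unitaryDiag U (fun i => d i * e i) := by
  have h := conjTranspose_mul_self_of_mem_unitaryGroup hU
  calc _ = U * Matrix.diagonal (fun i => (d i : ℂ)) * (Uᴴ * U) *
        Matrix.diagonal (fun i => (e i : ℂ)) * Uᴴ := by simp only [unitaryDiag, mul_assoc]
    _ = _ := by
      rw [h, mul_one, mul_assoc U, Matrix.diagonal_mul_diagonal, unitaryDiag]
      push_cast
      rfl

theorem unitaryDiag_sub {n : ℕ} (U : M n) (d e : Fin n → ℝ) :
    unitaryDiag U d - unitaryDiag U e = unitaryDiag U (fun i => d i - e i) := by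
  simp only [unitaryDiag, ← sub_mul, ← mul_sub, Matrix.diagonal_sub, Complex.ofReal_sub]

theorem smul_unitaryDiag {n : ℕ} (U : M n) (c : ℝ) (d : Fin n → ℝ) :
    (c : ℂ) • unitaryDiag U d = unitaryDiag U (fun i => c * d i) := by
  have h : Matrix.diagonal (fun i => ((c * d i : ℝ) : ℂ)) =
      (c : ℂ) • Matrix.diagonal (fun i => (d i : ℂ)) := by
    rw [← Matrix.diagonal_smul]
    congr 1
    ext i
    simp
  rw [unitaryDiag, unitaryDiag, h, Matrix.mul_smul, Matrix.smul_mul]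

theorem unitaryDiag_one {n : ℕ} {U : M n} (hU : U ∈ Matrix.unitaryGroup (Fin n) ℂ) :
    unitaryDiag U (fun _ => 1) = 1 := by
  simp [unitaryDiag, mul_conjTranspose_self_of_mem_unitaryGroup hU]

theorem posSemidef_unitaryDiag {n : ℕ} (U : M n) {d : Fin n → ℝ} (hd : ∀ i, 0 ≤ d i) :
    (unitaryDiag U d).PosSemidef :=
  (Matrix.PosSemidef.diagonal fun i => by simpa using hd i).mul_mul_conjTranspose_same U

theorem isUnit_of_mem_unitaryGroup {n : ℕ} {U : M n}
    (hU : U ∈ Matrix.unitaryGroup (Fin n) ℂ) : IsUnit U :=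
  .of_mul_eq_one _ (mul_conjTranspose_self_of_mem_unitaryGroup hU)

theorem rank_unitaryDiag {n : ℕ} {U : M n} (hU : U ∈ Matrix.unitaryGroup (Fin n) ℂ)
    (d : Fin n → ℝ) : (unitaryDiag U d).rank = (Finset.univ.filter fun i => d i ≠ 0).card := by
  have h1 : IsUnit U.det := (Matrix.isUnit_iff_isUnit_det _).mp (isUnit_of_mem_unitaryGroup hU)
  have h2 : IsUnit (Uᴴ).det := by
    rw [Matrix.det_conjTranspose]; exact h1.star
  rw [unitaryDiag, Matrix.rank_mul_eq_left_of_isUnit_det _ _ h2,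
    Matrix.rank_mul_eq_right_of_isUnit_det _ _ h1, Matrix.rank_diagonal, Fintype.card_subtype]
  simp

theorem quadForm_unitaryDiag_mulVec_single {n : ℕ} {U : M n}
    (hU : U ∈ Matrix.unitaryGroup (Fin n) ℂ) (d : Fin n → ℝ) (i : Fin n) :
    quadForm (unitaryDiag U d) (U *ᵥ Pi.single i 1) = d i := by
  rw [quadForm_unitaryDiag, Matrix.mulVec_mulVec,
    conjTranspose_mul_self_of_mem_unitaryGroup hU, Matrix.one_mulVec,
    Finset.sum_eq_single i] <;> simp +contextual

theorem normSq_mulVec_single {n : ℕ} {U : M n}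
    (hU : U ∈ Matrix.unitaryGroup (Fin n) ℂ) (i : Fin n) :
    normSq (U *ᵥ Pi.single i 1) = 1 := by
  have h := quadForm_unitaryDiag_mulVec_single hU (fun _ => 1) i
  rwa [unitaryDiag_one hU, quadForm_one] at h

theorem nonneg_of_posSemidef_unitaryDiag {n : ℕ} {U : M n}
    (hU : U ∈ Matrix.unitaryGroup (Fin n) ℂ) {d : Fin n → ℝ}
    (h : (unitaryDiag U d).PosSemidef) (i : Fin n) : 0 ≤ d i := by
  rw [← quadForm_unitaryDiag_mulVec_single hU d i]
  exact quadForm_nonneg h _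

theorem trace_unitaryDiag_mul {n : ℕ} (U : M n) (d : Fin n → ℝ) (C : M n) :
    (unitaryDiag U d * C).trace.re = ∑ i, d i * quadForm C (U *ᵥ Pi.single i 1) := by
  have h : (unitaryDiag U d * C).trace =
      (Matrix.diagonal (fun i => (d i : ℂ)) * (Uᴴ * C * U)).trace := by
    rw [unitaryDiag, mul_assoc, mul_assoc, Matrix.trace_mul_comm]
    simp only [mul_assoc]
  rw [h, Matrix.trace, Complex.re_sum]
  refine Finset.sum_congr rfl fun i _ => ?_
  rw [Matrix.diag_apply, Matrix.diagonal_mul, Complex.re_ofReal_mul, quadForm,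
    Matrix.star_mulVec, ← Matrix.dotProduct_mulVec, Matrix.mulVec_mulVec, Matrix.mulVec_mulVec,
    Matrix.mulVec_single_one, ← Pi.single_star]
  simp [Matrix.col_apply]

theorem trace_vecMulVec_star_mul {n : ℕ} (v : Fin n → ℂ) (B : M n) :
    (Matrix.vecMulVec v (star v) * B).trace = star v ⬝ᵥ B *ᵥ v := by
  rw [Matrix.vecMulVec_mul, Matrix.trace_vecMulVec, dotProduct_comm, Matrix.dotProduct_mulVec]

/-! ### Approximately scalable maps are rank non-decreasing -/

theorem isHermitian_map {n : ℕ} (E : M n →ₚ[ℂ] M n) {A : M n} (hA : A.IsHermitian) :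
    (E A).IsHermitian := by
  have h : E Aᴴ = (E A)ᴴ := map_star E A
  rw [Matrix.IsHermitian, ← h, hA.eq]

theorem trace_mul_adjointMap_one {n : ℕ} (E : M n →ₚ[ℂ] M n) {A : M n} (hA : A.IsHermitian) :
    (A * adjointMap E 1).trace = (E A).trace := by
  have h := trace_adjointMap E A 1
  rwa [hA.eq, mul_one, (isHermitian_map E hA).eq] at h

theorem posSemidef_adjointMap_one {n : ℕ} (E : M n →ₚ[ℂ] M n) :
    (adjointMap E 1).PosSemidef := by
  have hs : ∀ A : M n, E Aᴴ = (E A)ᴴ := fun A => map_star E A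
  refine .of_dotProduct_mulVec_nonneg ?_ fun v => ?_
  · ext i j
    simp only [adjointMap, Matrix.conjTranspose_apply, Matrix.of_apply, mul_one]
    rw [← hs, ← hs, ← Matrix.trace_conjTranspose, ← hs]
    simp
  · have hv := Matrix.posSemidef_vecMulVec_self_star v
    rw [← trace_vecMulVec_star_mul, trace_mul_adjointMap_one E hv.1]
    exact (posSemidef_map E hv).trace_nonneg

/-- tr H² is the sum of the squared eigenvalues, so it dominates each of them. -/
theorem abs_quadForm_le {n : ℕ} {H : M n} (hH : H.IsHermitian) {ε : ℝ} (hε : 0 ≤ ε)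
    (h : (H ^ 2).trace.re ≤ ε ^ 2) (v : Fin n → ℂ) : |quadForm H v| ≤ ε * normSq v := by
  obtain ⟨U, hU, d, -, rfl⟩ := exists_eq_unitaryDiag hH
  rw [pow_two, unitaryDiag_mul hU, trace_unitaryDiag hU, Complex.ofReal_re] at h
  have hd : ∀ i, |d i| ≤ ε := fun i => abs_le_of_sq_le_sq (by
    refine le_trans ?_ h
    rw [pow_two]
    exact Finset.single_le_sum (f := fun i => d i * d i)
      (fun j _ => mul_self_nonneg (d j)) (Finset.mem_univ i)) hε
  rw [quadForm_unitaryDiag, ← normSq_conjTranspose_mulVec hU, normSq, Finset.mul_sum]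
  refine (Finset.abs_sum_le_sum_abs _ _).trans (Finset.sum_le_sum fun i _ => ?_)
  rw [abs_mul, abs_of_nonneg (by positivity : (0 : ℝ) ≤ ‖(Uᴴ *ᵥ v) i‖ ^ 2)]
  exact mul_le_mul_of_nonneg_right (hd i) (by positivity)

theorem trace_sq_re_nonneg {n : ℕ} {H : M n} (hH : H.IsHermitian) : 0 ≤ (H ^ 2).trace.re := by
  obtain ⟨U, hU, d, -, rfl⟩ := exists_eq_unitaryDiag hH
  rw [pow_two, unitaryDiag_mul hU, trace_unitaryDiag hU, Complex.ofReal_re]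
  exact Finset.sum_nonneg fun i _ => mul_self_nonneg _

theorem abs_quadForm_sub_one_le_of_DS_le {n : ℕ} {E : M n →ₚ[ℂ] M n} {ε : ℝ} (hε : 0 ≤ ε)
    (h : DS E ≤ ε ^ 2) (v : Fin n → ℂ) :
    |quadForm (E 1) v - normSq v| ≤ ε * normSq v ∧
      |quadForm (adjointMap E 1) v - normSq v| ≤ ε * normSq v := by
  have h1 : (E 1 - 1).IsHermitian :=
    (isHermitian_map E Matrix.isHermitian_one).sub Matrix.isHermitian_one
  have h2 : (adjointMap E 1 - 1).IsHermitian :=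
    (posSemidef_adjointMap_one E).1.sub Matrix.isHermitian_one
  rw [DS, Complex.add_re] at h
  rw [← quadForm_one, ← quadForm_sub, ← quadForm_sub, quadForm_one]
  exact ⟨abs_quadForm_le h1 hε (by linarith [trace_sq_re_nonneg h2]) v,
    abs_quadForm_le h2 hε (by linarith [trace_sq_re_nonneg h1]) v⟩

theorem mulVec_eq_zero_of_quadForm_eq_zero {n : ℕ} {A : M n} (hA : A.PosSemidef)
    {v : Fin n → ℂ} (h : quadForm A v = 0) : A *ᵥ v = 0 := by
  obtain ⟨U, hU, d, -, rfl⟩ := exists_eq_unitaryDiag hA.1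
  have hd := nonneg_of_posSemidef_unitaryDiag hU hA
  rw [quadForm_unitaryDiag, Finset.sum_eq_zero_iff_of_nonneg
    fun i _ => mul_nonneg (hd i) (by positivity)] at h
  have h2 : Matrix.diagonal (fun i => (d i : ℂ)) *ᵥ (Uᴴ *ᵥ v) = 0 := by
    ext i
    rw [Matrix.mulVec_diagonal]
    simpa using h i (Finset.mem_univ i)
  rw [unitaryDiag, mul_assoc, ← Matrix.mulVec_mulVec, ← Matrix.mulVec_mulVec, h2,
    Matrix.mulVec_zero]

/-- The inequality forces ker B ≤ ker A, and rank-nullity converts this into ranks. -/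
theorem rank_le_rank_of_quadForm_le {n : ℕ} {A B : M n} (hA : A.PosSemidef)
    {c : ℝ} (hc : 0 < c) (h : ∀ v, c * quadForm A v ≤ quadForm B v) : A.rank ≤ B.rank := by
  have hker : LinearMap.ker B.mulVecLin ≤ LinearMap.ker A.mulVecLin := fun v hv => by
    rw [LinearMap.mem_ker, Matrix.mulVecLin_apply] at hv ⊢
    have h1 := h v
    rw [quadForm.eq_1 B, hv, dotProduct_zero, Complex.zero_re] at h1
    exact mulVec_eq_zero_of_quadForm_eq_zero hA
      (le_antisymm (nonpos_of_mul_nonpos_right h1 hc) (quadForm_nonneg hA v))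
  have h1 := LinearMap.finrank_range_add_finrank_ker A.mulVecLin
  have h2 := LinearMap.finrank_range_add_finrank_ker B.mulVecLin
  have h3 := Submodule.finrank_mono hker
  rw [Matrix.rank, Matrix.rank]
  lia

theorem exists_pos_le_of_ne_zero {ι : Type*} [Finite ι] {d : ι → ℝ} (hd : ∀ i, 0 ≤ d i) :
    ∃ a > 0, ∀ i, d i ≠ 0 → a ≤ d i := by
  have h : ∀ᶠ a in nhdsWithin (0 : ℝ) (Set.Ioi 0), ∀ i, d i ≠ 0 → a ≤ d i := by
    refine Filter.eventually_all.mpr fun i => ?_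
    by_cases hi : d i = 0
    · simp [hi]
    · have hpos : 0 < d i := lt_of_le_of_ne (hd i) (Ne.symm hi)
      filter_upwards [Ioc_mem_nhdsGT hpos] with a ha _
      exact ha.2
  obtain ⟨a, ha, ha'⟩ := (h.and self_mem_nhdsWithin).exists
  exact ⟨a, ha', ha⟩

/-- Only the nonzero eigenvalues contribute, and each is at most c. -/
theorem trace_le_rank_mul {n : ℕ} {A : M n} (hA : A.PosSemidef) {c : ℝ}
    (h : ∀ v, quadForm A v ≤ c * normSq v) : A.trace.re ≤ A.rank * c := by
  obtain ⟨U, hU, d, -, rfl⟩ := exists_eq_unitaryDiag hA.1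
  rw [trace_unitaryDiag hU, rank_unitaryDiag hU, Complex.ofReal_re,
    ← Finset.sum_filter_ne_zero, ← nsmul_eq_mul]
  refine Finset.sum_le_card_nsmul _ _ _ fun i _ => ?_
  have := h (U *ᵥ Pi.single i 1)
  rwa [quadForm_unitaryDiag_mulVec_single hU, normSq_mulVec_single hU, mul_one] at this

theorem rank_le_rank_map_of_DS_le {n : ℕ} {E : M n →ₚ[ℂ] M n}
    (h : DS E ≤ (1 / (2 * (n + 1)) : ℝ) ^ 2) {A : M n} (hA : A.PosSemidef) :
    A.rank ≤ (E A).rank := by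
  obtain ⟨ε, hε⟩ : ∃ ε : ℝ, ε = 1 / (2 * (n + 1)) := ⟨_, rfl⟩
  rw [← hε] at h
  have hε0 : 0 < ε := by rw [hε]; positivity
  obtain ⟨U, hU, d, -, rfl⟩ := exists_eq_unitaryDiag hA.1
  have hd := nonneg_of_posSemidef_unitaryDiag hU hA
  obtain ⟨a, ha, had⟩ := exists_pos_le_of_ne_zero hd
  -- The support projection of A. Since A ≥ a P, it suffices to bound the rank of E(P), where
  -- eigenvalue sizes no longer matter.
  set p : Fin n → ℝ := fun i => if d i ≠ 0 then 1 else 0 with hp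
  have hp0 : ∀ i, 0 ≤ p i := fun i => by simp only [hp]; split_ifs <;> norm_num
  have hp1 : ∀ i, p i ≤ 1 := fun i => by simp only [hp]; split_ifs <;> norm_num
  have hP := posSemidef_unitaryDiag U hp0
  have hEP := posSemidef_map E hP
  have hmono : (E (unitaryDiag U p)).rank ≤ (E (unitaryDiag U d)).rank := by
    refine rank_le_rank_of_quadForm_le hEP ha fun v => ?_
    rw [← quadForm_smul, ← sub_nonneg, ← quadForm_sub, ← map_smul, ← map_sub, smul_unitaryDiag,
      unitaryDiag_sub]
    refine quadForm_nonneg (posSemidef_map E (posSemidef_unitaryDiag U fun i => ?_)) v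
    simp only [hp]
    split_ifs with hi
    · linarith [had i hi]
    · linarith [hd i]
  refine le_trans ?_ hmono
  have hupper : (E (unitaryDiag U p)).trace.re ≤ (E (unitaryDiag U p)).rank * (1 + ε) := by
    refine trace_le_rank_mul hEP fun v => ?_
    have h1 : 0 ≤ quadForm (E (unitaryDiag U (fun _ => 1) - unitaryDiag U p)) v := by
      rw [unitaryDiag_sub]
      exact quadForm_nonneg (posSemidef_map E
        (posSemidef_unitaryDiag U fun i => sub_nonneg.mpr (hp1 i))) v
    rw [map_sub, quadForm_sub, unitaryDiag_one hU] at h1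
    linarith [abs_le.mp (abs_quadForm_sub_one_le_of_DS_le hε0.le h v).1]
  have hlower : (unitaryDiag U d).rank * (1 - ε) ≤ (E (unitaryDiag U p)).trace.re := by
    rw [← trace_mul_adjointMap_one E hP.1, trace_unitaryDiag_mul, rank_unitaryDiag hU,
      Finset.card_filter]
    push_cast
    rw [Finset.sum_mul]
    refine Finset.sum_le_sum fun i _ => mul_le_mul_of_nonneg_left ?_ (hp0 i)
    have h1 := (abs_quadForm_sub_one_le_of_DS_le hε0.le h (U *ᵥ Pi.single i 1)).2
    rw [normSq_mulVec_single hU] at h1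
    linarith [abs_le.mp h1]
  by_contra! hlt
  have h1 : ((E (unitaryDiag U p)).rank : ℝ) + 1 ≤ (unitaryDiag U d).rank := by exact_mod_cast hlt
  have h2 : ((unitaryDiag U d).rank : ℝ) ≤ n := by exact_mod_cast Matrix.rank_le_width _
  have h3 : ε * (2 * (n + 1)) = 1 := by rw [hε]; field_simp
  -- With r = rank A, r(1-ε) ≤ (r-1)(1+ε) would give 1+ε ≤ 2rε ≤ 2nε = n/(n+1) < 1.
  nlinarith

/-- If Xv = 0, the scaled map kills v vᴴ, so its adjoint at 1 has zero quadratic form at v, although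
this form should be close to ‖v‖². -/
theorem isUnit_of_DS_scaling_le {n : ℕ} {E : M n →ₚ[ℂ] M n} {X Y : M n} {ε : ℝ}
    (hε : 0 ≤ ε) (hε1 : ε < 1) (h : DS (scaling X Y E) ≤ ε ^ 2) : IsUnit X := by
  rw [Matrix.isUnit_iff_isUnit_det, isUnit_iff_ne_zero]
  intro hdet
  obtain ⟨v, hv, hXv⟩ := Matrix.exists_mulVec_eq_zero_iff.mpr hdet
  have h1 := abs_le.mp (abs_quadForm_sub_one_le_of_DS_le hε h v).2
  have h2 : quadForm (adjointMap (scaling X Y E) 1) v = 0 := by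
    rw [quadForm, ← trace_vecMulVec_star_mul,
      trace_mul_adjointMap_one _ (Matrix.posSemidef_vecMulVec_self_star v).1, scaling_apply,
      Matrix.mul_vecMulVec, hXv]
    simp
  rw [h2] at h1
  nlinarith [normSq_pos hv]

theorem isRankNonDecreasing_of_isApproxScalable {n : ℕ} {E : M n →ₚ[ℂ] M n}
    (h : IsApproxScalable E) : IsRankNonDecreasing E := by
  intro A hA
  have hε : (0 : ℝ) < 1 / (2 * (n + 1)) := by positivity
  have hε1 : (1 : ℝ) / (2 * (n + 1)) < 1 := by
    rw [div_lt_one (by positivity)]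
    linarith [(Nat.cast_nonneg n : (0 : ℝ) ≤ n)]
  obtain ⟨X, Y, hXY⟩ := h _ hε
  have hX := (Matrix.isUnit_iff_isUnit_det _).mp (isUnit_of_DS_scaling_le hε.le hε1 hXY)
  have hXi : IsUnit (X⁻¹).det := by rwa [Matrix.isUnit_nonsing_inv_det_iff]
  have hXi' : IsUnit (X⁻¹ᴴ).det := by rw [Matrix.det_conjTranspose]; exact hXi.star
  have h1 := rank_le_rank_map_of_DS_le hXY (hA.mul_mul_conjTranspose_same X⁻¹)
  have h2 : X * (X⁻¹ * A * X⁻¹ᴴ) * Xᴴ = A := by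
    calc _ = (X * X⁻¹) * A * (X * X⁻¹)ᴴ := by
          rw [Matrix.conjTranspose_mul]; simp only [mul_assoc]
      _ = A := by simp [Matrix.mul_nonsing_inv _ hX]
  rw [scaling_apply, h2, Matrix.rank_mul_eq_left_of_isUnit_det _ _ hXi',
    Matrix.rank_mul_eq_right_of_isUnit_det _ _ hXi] at h1
  -- Y may be singular: multiplying by it can only lower the rank.
  exact h1.trans ((Matrix.rank_mul_le_left _ _).trans (Matrix.rank_mul_le_right _ _))

/-! ### Min-max estimates and positivity of the capacity -/

/-- The quadratic form of `A` is at least `a` times the squared norm on some subspace of dimension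
at least `k`. -/
def BoundedBelowOnDim {n : ℕ} (A : M n) (k : ℕ) (a : ℝ) : Prop :=
  ∃ V : Submodule ℂ (Fin n → ℂ), k ≤ Module.finrank ℂ V ∧
    ∀ v ∈ V, a * normSq v ≤ quadForm A v

theorem BoundedBelowOnDim.mono {n : ℕ} {A : M n} {k l : ℕ} {a b : ℝ}
    (h : BoundedBelowOnDim A l b) (hkl : k ≤ l) (hab : a ≤ b) : BoundedBelowOnDim A k a := by
  obtain ⟨V, hV, hVb⟩ := h
  exact ⟨V, hkl.trans hV, fun v hv =>
    (mul_le_mul_of_nonneg_right hab (normSq_nonneg v)).trans (hVb v hv)⟩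

/-- Half of Courant–Fischer; with indices from 0, `d k` is the (k+1)-st largest eigenvalue. A space
of dimension k+1 contains a nonzero vector whose first k eigencoordinates vanish. -/
theorem BoundedBelowOnDim.le_of_antitone {n : ℕ} {U : M n}
    (hU : U ∈ Matrix.unitaryGroup (Fin n) ℂ) {d : Fin n → ℝ} (hd : Antitone d) {k : Fin n} {a : ℝ}
    (h : BoundedBelowOnDim (unitaryDiag U d) (k + 1) a) : a ≤ d k := by
  obtain ⟨V, hV, hVa⟩ := h
  let f : V →ₗ[ℂ] (Fin k → ℂ) :=
    (LinearMap.funLeft ℂ ℂ (Fin.castLE k.2.le)) ∘ₗ (Uᴴ).mulVecLin ∘ₗ V.subtype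
  have hker : LinearMap.ker f ≠ ⊥ := LinearMap.ker_ne_bot_of_finrank_lt (by simpa using hV)
  obtain ⟨⟨v, hvV⟩, hvk, hv0⟩ := (Submodule.ne_bot_iff _).mp hker
  have hv0' : v ≠ 0 := fun h0 => hv0 (by simp [h0])
  have hz : ∀ j : Fin n, j < k → (Uᴴ *ᵥ v) j = 0 := fun j hj =>
    congrFun (LinearMap.mem_ker.mp hvk) ⟨j, hj⟩
  have h1 := hVa v hvV
  have h2 : quadForm (unitaryDiag U d) v ≤ d k * normSq v := by
    rw [quadForm_unitaryDiag, ← normSq_conjTranspose_mulVec hU, normSq, Finset.mul_sum]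
    refine Finset.sum_le_sum fun i _ => ?_
    rcases lt_or_ge i k with hi | hi
    · simp [hz i hi]
    · exact mul_le_mul_of_nonneg_right (hd hi) (by positivity)
  exact le_of_mul_le_mul_right (h1.trans h2) (normSq_pos hv0')

theorem exists_boundedBelowOnDim_rank {n : ℕ} {A : M n} (hA : A.PosSemidef) :
    ∃ a > 0, BoundedBelowOnDim A A.rank a := by
  -- The range of A serves as the subspace: its vectors have no component along eigenvectors of
  -- eigenvalue 0.
  obtain ⟨U, hU, d, -, rfl⟩ := exists_eq_unitaryDiag hA.1
  obtain ⟨a, ha, had⟩ := exists_pos_le_of_ne_zero (nonneg_of_posSemidef_unitaryDiag hU hA)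
  refine ⟨a, ha, LinearMap.range (unitaryDiag U d).mulVecLin, le_rfl, ?_⟩
  rintro _ ⟨u, rfl⟩
  rw [Matrix.mulVecLin_apply, quadForm_unitaryDiag, ← normSq_conjTranspose_mulVec hU, normSq,
    Finset.mul_sum]
  refine Finset.sum_le_sum fun i _ => ?_
  have h : Uᴴ *ᵥ unitaryDiag U d *ᵥ u =
      Matrix.diagonal (fun i => (d i : ℂ)) *ᵥ (Uᴴ *ᵥ u) := by
    rw [Matrix.mulVec_mulVec, Matrix.mulVec_mulVec, unitaryDiag, mul_assoc, ← mul_assoc,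
      conjTranspose_mul_self_of_mem_unitaryGroup hU, one_mul]
  rw [h, Matrix.mulVec_diagonal]
  by_cases hi : d i = 0
  · simp [hi]
  · exact mul_le_mul_of_nonneg_right (had i hi) (by positivity)

theorem abs_quadForm_le_of_norm_le {n : ℕ} {A : M n} {η : ℝ} (h : ∀ i j, ‖A i j‖ ≤ η)
    (v : Fin n → ℂ) : |quadForm A v| ≤ η * n * normSq v := by
  have hterm : ∀ i j, ‖star (v i) * (A i j * v j)‖ ≤ η / 2 * (‖v i‖ ^ 2 + ‖v j‖ ^ 2) := by
    intro i j
    rw [norm_mul, norm_mul, norm_star]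
    have h1 := mul_le_mul_of_nonneg_right (h i j)
      (by positivity : 0 ≤ (‖v i‖ ^ 2 + ‖v j‖ ^ 2) / 2)
    have h2 := mul_nonneg (norm_nonneg (A i j)) (sq_nonneg (‖v i‖ - ‖v j‖))
    nlinarith
  calc |quadForm A v| ≤ ‖star v ⬝ᵥ A *ᵥ v‖ := Complex.abs_re_le_norm _
    _ = ‖∑ i, ∑ j, star (v i) * (A i j * v j)‖ := by
      simp only [dotProduct, Matrix.mulVec, Finset.mul_sum, Pi.star_apply]
    _ ≤ ∑ i, ∑ j, η / 2 * (‖v i‖ ^ 2 + ‖v j‖ ^ 2) :=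
      (norm_sum_le _ _).trans (Finset.sum_le_sum fun i _ =>
        (norm_sum_le _ _).trans (Finset.sum_le_sum fun j _ => hterm i j))
    _ = η * n * normSq v := by
      simp only [← Finset.mul_sum, Finset.sum_add_distrib, Finset.sum_const, Finset.card_univ,
        Fintype.card_fin, nsmul_eq_mul, normSq]
      ring

/-- A quantitative form of lower semicontinuity of rank: the same subspace works for nearby
matrices, at the cost of half the bound. -/
theorem BoundedBelowOnDim.eventually {n : ℕ} {A : M n} {k : ℕ} {a : ℝ}
    (h : BoundedBelowOnDim A k a) (ha : 0 < a) :
    ∀ᶠ B in nhds A, BoundedBelowOnDim B k (a / 2) := by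
  obtain ⟨V, hV, hVa⟩ := h
  have hη : 0 < a / (2 * (n + 1)) := by positivity
  have hev : ∀ᶠ B in nhds A, ∀ i j, ‖(A - B) i j‖ < a / (2 * (n + 1)) := by
    refine Filter.eventually_all.mpr fun i => Filter.eventually_all.mpr fun j => ?_
    have hc : Continuous fun B : M n => ‖(A - B) i j‖ :=
      ((continuous_const.sub continuous_id).matrix_elem i j).norm
    exact (hc.tendsto A).eventually_lt_const (by simpa using hη)
  filter_upwards [hev] with B hB
  refine ⟨V, hV, fun v hv => ?_⟩
  have h1 := le_of_abs_le (abs_quadForm_le_of_norm_le (fun i j => (hB i j).le) v)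
  rw [quadForm_sub] at h1
  have h2 : a / (2 * (n + 1)) * n ≤ a / 2 := by
    rw [div_mul_eq_mul_div, div_le_div_iff₀ (by positivity) (by norm_num)]
    nlinarith
  have h3 := mul_le_mul_of_nonneg_right h2 (normSq_nonneg v)
  linarith [hVa v hv]

theorem isCompact_unitaryGroup (n : ℕ) :
    IsCompact {U : M n | U ∈ Matrix.unitaryGroup (Fin n) ℂ} := by
  have hK : IsCompact (Set.univ.pi fun _ : Fin n => Set.univ.pi fun _ : Fin n =>
      Metric.closedBall (0 : ℂ) 1) :=
    isCompact_univ_pi fun _ => isCompact_univ_pi fun _ => isCompact_closedBall _ _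
  refine IsCompact.of_isClosed_subset (X := M n) hK ?_ ?_
  · simp only [Matrix.mem_unitaryGroup_iff]
    exact isClosed_eq (continuous_id.mul continuous_star) continuous_const
  · intro U hU i _ j _
    simpa using entry_norm_bound_of_unitary hU i j

theorem continuous_map_unitaryDiag {n : ℕ} (E : M n →ₚ[ℂ] M n) (d : Fin n → ℝ) :
    Continuous fun U : M n => E (unitaryDiag U d) := by
  have h1 : Continuous fun U : M n => unitaryDiag U d :=
    (continuous_id.mul continuous_const).mul continuous_star
  exact (LinearMap.continuous_of_finiteDimensional E.toLinearMap).comp h1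

/-- Rank non-decrease gives a positive bound at each U, which persists near U; compactness makes it
uniform. -/
theorem IsRankNonDecreasing.exists_boundedBelowOnDim {n : ℕ} {E : M n →ₚ[ℂ] M n}
    (hE : IsRankNonDecreasing E) (k : Fin n) :
    ∃ c > 0, ∀ U ∈ Matrix.unitaryGroup (Fin n) ℂ,
      BoundedBelowOnDim (E (unitaryDiag U fun i => if i ≤ k then 1 else 0)) (k + 1) c := by
  set p : Fin n → ℝ := fun i => if i ≤ k then 1 else 0 with hp
  have hp0 : ∀ i, 0 ≤ p i := fun i => by simp only [hp]; split_ifs <;> norm_num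
  refine (isCompact_unitaryGroup n).induction_on
    (p := fun S => ∃ c > 0, ∀ U ∈ S, BoundedBelowOnDim (E (unitaryDiag U p)) (k + 1) c)
    ⟨1, one_pos, fun _ h => h.elim⟩ ?_ ?_ ?_
  · rintro s t hst ⟨c, hc, h⟩
    exact ⟨c, hc, fun U hU => h U (hst hU)⟩
  · rintro s t ⟨c, hc, h⟩ ⟨c', hc', h'⟩
    refine ⟨min c c', lt_min hc hc', ?_⟩
    rintro U (hU | hU)
    · exact (h U hU).mono le_rfl (min_le_left _ _)
    · exact (h' U hU).mono le_rfl (min_le_right _ _)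
  · intro U hU
    have hP := posSemidef_unitaryDiag U hp0
    obtain ⟨a, ha, hb⟩ := exists_boundedBelowOnDim_rank (posSemidef_map E hP)
    have hrank : (k : ℕ) + 1 ≤ (E (unitaryDiag U p)).rank := by
      refine le_trans (le_of_eq ?_) (hE _ hP)
      rw [rank_unitaryDiag hU, ← Fin.card_Iic k]
      congr 1
      ext i
      simp [hp]
    have hev := (continuous_map_unitaryDiag E p).continuousAt.eventually
      ((hb.mono hrank le_rfl).eventually ha)
    exact ⟨_, mem_nhdsWithin_of_mem_nhds hev, a / 2, by positivity, fun _ h => h⟩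

/-- A rank non-decreasing positive map has positive capacity. -/
theorem IsRankNonDecreasing.exists_mul_det_le {n : ℕ} {E : M n →ₚ[ℂ] M n}
    (hE : IsRankNonDecreasing E) :
    ∃ c > 0, ∀ X : M n, X.PosDef → c * X.det.re ≤ (E X).det.re := by
  choose c hc h using hE.exists_boundedBelowOnDim
  refine ⟨∏ k, c k, Finset.prod_pos fun k _ => hc k, fun X hX => ?_⟩
  have hEX := posSemidef_map E hX.posSemidef
  obtain ⟨U, hU, x, hx, rfl⟩ := exists_eq_unitaryDiag hX.1
  have hx0 := nonneg_of_posSemidef_unitaryDiag hU hX.posSemidef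
  obtain ⟨W, hW, d, hd, hEd⟩ := exists_eq_unitaryDiag hEX.1
  rw [hEd, det_unitaryDiag hU, det_unitaryDiag hW, Complex.ofReal_re, Complex.ofReal_re,
    ← Finset.prod_mul_distrib]
  refine Finset.prod_le_prod (fun k _ => mul_nonneg (hc k).le (hx0 k)) fun k _ => ?_
  refine BoundedBelowOnDim.le_of_antitone hW hd ?_
  rw [← hEd]
  obtain ⟨V, hV, hVc⟩ := h k U hU
  refine ⟨V, hV, fun v hv => ?_⟩
  -- X ≥ x_k P_k, because the eigenvalues decrease and are nonnegative.
  have h1 : x k * quadForm (E (unitaryDiag U fun i => if i ≤ k then 1 else 0)) v ≤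
      quadForm (E (unitaryDiag U x)) v := by
    rw [← quadForm_smul, ← sub_nonneg, ← quadForm_sub, ← map_smul, ← map_sub, smul_unitaryDiag,
      unitaryDiag_sub]
    refine quadForm_nonneg (posSemidef_map E (posSemidef_unitaryDiag U fun i => ?_)) v
    split_ifs with hi
    · simpa using hx hi
    · simpa using hx0 i
  have h2 := mul_le_mul_of_nonneg_left (hVc v hv) (hx0 k)
  linarith

/-! ### Scaling at a near-minimizer of the capacity -/

theorem posDef_unitaryDiag {n : ℕ} {U : M n} (hU : U ∈ Matrix.unitaryGroup (Fin n) ℂ)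
    {d : Fin n → ℝ} (hd : ∀ i, 0 < d i) : (unitaryDiag U d).PosDef :=
  (Matrix.IsUnit.posDef_star_right_conjugate_iff (isUnit_of_mem_unitaryGroup hU)).mpr
    (Matrix.PosDef.diagonal fun i => by simpa using hd i)

theorem ofReal_det_re {n : ℕ} {A : M n} (hA : A.IsHermitian) : ((A.det.re : ℝ) : ℂ) = A.det := by
  obtain ⟨U, hU, d, -, rfl⟩ := exists_eq_unitaryDiag hA
  rw [det_unitaryDiag hU, Complex.ofReal_re]

theorem det_re_pos {n : ℕ} {A : M n} (hA : A.PosDef) : 0 < A.det.re :=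
  (Complex.pos_iff.mp hA.det_pos).1

theorem posDef_of_det_re_pos {n : ℕ} {A : M n} (hA : A.PosSemidef) (h : 0 < A.det.re) :
    A.PosDef := by
  obtain ⟨U, hU, d, -, rfl⟩ := exists_eq_unitaryDiag hA.1
  have hd := nonneg_of_posSemidef_unitaryDiag hU hA
  rw [det_unitaryDiag hU, Complex.ofReal_re] at h
  exact posDef_unitaryDiag hU fun i => lt_of_le_of_ne (hd i) fun h0 =>
    h.ne' (Finset.prod_eq_zero (Finset.mem_univ i) h0.symm)

theorem exists_isUnit_mul_conjTranspose_eq {n : ℕ} {A : M n} (hA : A.PosDef) :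
    ∃ S : M n, IsUnit S.det ∧ S * Sᴴ = A := by
  obtain ⟨U, hU, d, -, rfl⟩ := exists_eq_unitaryDiag hA.1
  have hd := nonneg_of_posSemidef_unitaryDiag hU hA.posSemidef
  have h : unitaryDiag U (fun i => √(d i)) * (unitaryDiag U (fun i => √(d i)))ᴴ =
      unitaryDiag U d := by
    rw [(posSemidef_unitaryDiag U fun i => Real.sqrt_nonneg (d i)).1.eq, unitaryDiag_mul hU]
    simp only [Real.mul_self_sqrt (hd _)]
  refine ⟨_, ?_, h⟩
  have h2 := hA.det_pos.ne'
  rw [← h, Matrix.det_mul] at h2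
  exact isUnit_iff_ne_zero.mpr (left_ne_zero_of_mul h2)

/-- Near-minimizers of the capacity. -/
theorem IsRankNonDecreasing.exists_near_minimizer {n : ℕ} {E : M n →ₚ[ℂ] M n}
    (hE : IsRankNonDecreasing E) {δ : ℝ} (hδ : 0 < δ) :
    ∃ X : M n, X.PosDef ∧ (E X).PosDef ∧ ∀ Z : M n, Z.PosDef →
      Real.exp (-δ) * ((E X).det.re / X.det.re) ≤ (E Z).det.re / Z.det.re := by
  obtain ⟨c, hc, hcap⟩ := hE.exists_mul_det_le
  set S : Set ℝ := (fun Z : M n => (E Z).det.re / Z.det.re) '' {Z | Z.PosDef} with hS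
  have hlow : ∀ y ∈ S, c ≤ y := by
    rintro _ ⟨Z, hZ, rfl⟩
    exact (le_div_iff₀ (det_re_pos hZ)).mpr (hcap Z hZ)
  have hne : S.Nonempty := ⟨_, 1, Matrix.PosDef.one, rfl⟩
  have hinf : 0 < sInf S := hc.trans_le (le_csInf hne hlow)
  -- Positivity of the infimum is what makes a multiplicative error exp(δ) strict.
  have hlt : sInf S < Real.exp δ * sInf S :=
    lt_mul_of_one_lt_left hinf (Real.one_lt_exp_iff.mpr hδ)
  obtain ⟨_, ⟨X, hX, rfl⟩, hXlt⟩ := exists_lt_of_csInf_lt hne hlt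
  refine ⟨X, hX, posDef_of_det_re_pos (posSemidef_map E hX.posSemidef)
    ((mul_pos hc (det_re_pos hX)).trans_le (hcap X hX)), fun Z hZ => ?_⟩
  have h1 : sInf S ≤ (E Z).det.re / Z.det.re := csInf_le ⟨c, hlow⟩ ⟨Z, hZ, rfl⟩
  refine le_trans ?_ h1
  rw [Real.exp_neg, inv_mul_le_iff₀ (Real.exp_pos δ)]
  exact hXlt.le

/-- Follows from log u ≥ 1 - 1/u at u = 1 - y. -/
theorem exp_neg_sub_two_mul_sq_le {y : ℝ} (hy : y ≤ 1 / 2) :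
    Real.exp (-y - 2 * y ^ 2) ≤ 1 - y := by
  have hpos : 0 < 1 - y := by linarith
  rw [← Real.le_log_iff_exp_le hpos]
  refine le_trans ?_ (Real.one_sub_inv_le_log_of_pos hpos)
  have h : 1 - (1 - y)⁻¹ = -y / (1 - y) := by field_simp; ring
  rw [h, le_div_iff₀ hpos]
  nlinarith [mul_nonneg (sq_nonneg y) (by linarith : 0 ≤ 1 - 2 * y)]

/-- Apply d ≤ exp(d - 1) to each eigenvalue. -/
theorem det_re_le_exp_trace_sub {n : ℕ} {A : M n} (hA : A.PosSemidef) :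
    A.det.re ≤ Real.exp (A.trace.re - n) := by
  obtain ⟨U, hU, d, -, rfl⟩ := exists_eq_unitaryDiag hA.1
  have hd := nonneg_of_posSemidef_unitaryDiag hU hA
  rw [det_unitaryDiag hU, trace_unitaryDiag hU, Complex.ofReal_re, Complex.ofReal_re]
  calc ∏ i, d i ≤ ∏ i, Real.exp (d i - 1) :=
        Finset.prod_le_prod (fun i _ => hd i) fun i _ => by
          simpa using Real.add_one_le_exp (d i - 1)
    _ = _ := by simp [← Real.exp_sum, Finset.sum_sub_distrib]

/-- Let B = E*(1), of trace n since E is unital, and test A = 1 - t(B - 1). Then tr E(A) = tr(AB) =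
n - t·DS, so det E(A) ≤ exp(-t·DS), whereas det A ≥ exp(-2t²·DS): the gain is first order in t, the
loss second order. -/
theorem DS_le_of_det_le {n : ℕ} {E : M n →ₚ[ℂ] M n} (h1 : E 1 = 1) {δ : ℝ}
    (h : ∀ A : M n, A.PosDef → Real.exp (-δ) * A.det.re ≤ (E A).det.re) :
    DS E ≤ 8 * (n + 1) * δ := by
  have hBpos := posSemidef_adjointMap_one E
  have htr : (adjointMap E 1).trace = n := by
    have := trace_mul_adjointMap_one E (A := 1) Matrix.isHermitian_one
    rwa [one_mul, h1, Matrix.trace_one, Fintype.card_fin] at this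
  obtain ⟨U, hU, b, -, hB⟩ := exists_eq_unitaryDiag hBpos.1
  rw [hB] at hBpos htr
  have hb0 := nonneg_of_posSemidef_unitaryDiag hU hBpos
  have hsum : ∑ i, b i = n := by
    rw [trace_unitaryDiag hU] at htr
    exact_mod_cast htr
  have hbn : ∀ i, b i ≤ n := fun i => by
    rw [← hsum]
    exact Finset.single_le_sum (fun j _ => hb0 j) (Finset.mem_univ i)
  have hDS : DS E = ∑ i, (b i - 1) ^ 2 := by
    rw [DS, h1, hB, ← unitaryDiag_one hU, sub_self, unitaryDiag_sub, pow_two (unitaryDiag _ _),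
      unitaryDiag_mul hU, trace_unitaryDiag hU]
    simp [pow_two]
  -- Since b_i ≤ n, this t keeps t(b_i - 1) ≤ 1/2, so A is positive definite; t ≤ 1/4 also gives t -
  -- 2t² ≥ t/2. The final constant 8(n+1) is 2/t.
  obtain ⟨t, ht⟩ : ∃ t : ℝ, t = 1 / (4 * (n + 1)) := ⟨_, rfl⟩
  have ht0 : 0 < t := by rw [ht]; positivity
  have htn : t * (4 * (n + 1)) = 1 := by rw [ht]; field_simp
  have hn : (0 : ℝ) ≤ n := Nat.cast_nonneg n
  have htn' : t * n ≤ 1 / 4 := by nlinarith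
  have ht4 : t ≤ 1 / 4 := by nlinarith
  have hy : ∀ i, t * (b i - 1) ≤ 1 / 2 := fun i => by
    nlinarith [mul_le_mul_of_nonneg_left (hbn i) ht0.le]
  set a : Fin n → ℝ := fun i => 1 - t * (b i - 1) with ha
  have ha0 : ∀ i, 0 < a i := fun i => by simp only [ha]; linarith [hy i]
  have hA := posDef_unitaryDiag hU ha0
  have hup := det_re_le_exp_trace_sub (posSemidef_map E hA.posSemidef)
  have htrace : (E (unitaryDiag U a)).trace.re - n = -t * DS E := by
    rw [← trace_mul_adjointMap_one E hA.1, hB, unitaryDiag_mul hU, trace_unitaryDiag hU,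
      Complex.ofReal_re, hDS]
    have h2 : ∀ i, a i * b i = -t * (b i - 1) ^ 2 + b i - t * (b i - 1) := fun i => by
      simp only [ha]; ring
    simp only [h2, Finset.sum_sub_distrib, Finset.sum_add_distrib, ← Finset.mul_sum, hsum]
    simp
  have hlow : Real.exp (-(2 * t ^ 2 * DS E)) ≤ (unitaryDiag U a).det.re := by
    rw [det_unitaryDiag hU, Complex.ofReal_re]
    calc Real.exp (-(2 * t ^ 2 * DS E))
        = ∏ i, Real.exp (-(t * (b i - 1)) - 2 * (t * (b i - 1)) ^ 2) := by
          rw [← Real.exp_sum, hDS]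
          congr 1
          simp only [Finset.sum_sub_distrib, Finset.sum_neg_distrib, mul_pow, ← Finset.mul_sum,
            hsum]
          simp
          ring
      _ ≤ _ := Finset.prod_le_prod (fun i _ => (Real.exp_pos _).le) fun i _ =>
          exp_neg_sub_two_mul_sq_le (hy i)
  have hexp : Real.exp (-δ + -(2 * t ^ 2 * DS E)) ≤ Real.exp (-t * DS E) := by
    rw [Real.exp_add, ← htrace]
    exact ((mul_le_mul_of_nonneg_left hlow (Real.exp_pos _).le).trans (h _ hA)).trans hup
  have hle := Real.exp_le_exp.mp hexp
  have hDS0 : 0 ≤ DS E := by rw [hDS]; exact Finset.sum_nonneg fun i _ => sq_nonneg _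
  have h3 : t / 2 * DS E ≤ δ := by nlinarith [mul_nonneg hDS0 ht0.le]
  calc DS E = 8 * (n + 1) * (t / 2 * DS E) := by linear_combination (-DS E) * htn
    _ ≤ _ := mul_le_mul_of_nonneg_left h3 (by positivity)

theorem isApproxScalable_of_isRankNonDecreasing {n : ℕ} {E : M n →ₚ[ℂ] M n}
    (hE : IsRankNonDecreasing E) : IsApproxScalable E := by
  intro ε hε
  obtain ⟨δ, hδ⟩ : ∃ δ : ℝ, δ = ε ^ 2 / (8 * (n + 1)) := ⟨_, rfl⟩
  have hδ0 : 0 < δ := by rw [hδ]; positivity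
  have hδε : 8 * (n + 1) * δ = ε ^ 2 := by rw [hδ]; field_simp
  obtain ⟨X, hX, hEX, hmin⟩ := hE.exists_near_minimizer hδ0
  obtain ⟨S, hS, hSX⟩ := exists_isUnit_mul_conjTranspose_eq hX
  obtain ⟨T, hT, hTEX⟩ := exists_isUnit_mul_conjTranspose_eq hEX
  -- With S Sᴴ = X and T Tᴴ = E(X), this scaling sends 1 to T⁻¹ E(X) T⁻¹ᴴ = 1, and it divides the
  -- ratio det E(Z) / det Z by its value at X.
  refine ⟨S, T⁻¹ᴴ, ?_⟩
  rw [IsEpsDoublyStochastic, ← hδε]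
  have happ : ∀ A, scaling S T⁻¹ᴴ E A = T⁻¹ * E (S * A * Sᴴ) * T⁻¹ᴴ := fun A => by
    rw [scaling_apply, Matrix.conjTranspose_conjTranspose]
  refine DS_le_of_det_le ?_ fun A hA => ?_
  · rw [happ, mul_one, hSX, ← hTEX]
    calc _ = (T⁻¹ * T) * (T⁻¹ * T)ᴴ := by
          rw [Matrix.conjTranspose_mul]; simp only [mul_assoc]
      _ = 1 := by simp [Matrix.nonsing_inv_mul _ hT]
  · have hSu : IsUnit S := (Matrix.isUnit_iff_isUnit_det _).mpr hS
    have hZ : (S * A * Sᴴ).PosDef :=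
      (Matrix.IsUnit.posDef_star_right_conjugate_iff hSu).mpr hA
    have hEZ := posSemidef_map E hZ.posSemidef
    have hdetZ : (S * A * Sᴴ).det.re = X.det.re * A.det.re := by
      have h : (S * A * Sᴴ).det = X.det * A.det := by
        rw [← hSX, Matrix.det_mul, Matrix.det_mul, Matrix.det_mul]; ring
      rw [h, ← ofReal_det_re hX.1, Complex.re_ofReal_mul, Complex.ofReal_re]
    have hdetE : (E X).det.re * (scaling S T⁻¹ᴴ E A).det.re = (E (S * A * Sᴴ)).det.re := by
      rw [← Complex.re_ofReal_mul, ofReal_det_re hEX.1, happ, ← hTEX, ← Matrix.det_mul]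
      congr 1
      rw [Matrix.det_mul, Matrix.det_mul, Matrix.det_mul, Matrix.det_mul]
      have h1 : T.det * T⁻¹.det = 1 := by
        rw [← Matrix.det_mul, Matrix.mul_nonsing_inv _ hT, Matrix.det_one]
      have h2 : Tᴴ.det * T⁻¹ᴴ.det = 1 := by
        rw [Matrix.det_conjTranspose, Matrix.det_conjTranspose, ← star_mul', h1, star_one]
      linear_combination (E (S * A * Sᴴ)).det * (Tᴴ.det * T⁻¹ᴴ.det * h1 + h2)
    have h := hmin _ hZ
    have hXp := det_re_pos hX
    have hAp := det_re_pos hA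
    have hEXp := det_re_pos hEX
    rw [hdetZ, ← hdetE, le_div_iff₀ (mul_pos hXp hAp)] at h
    refine le_of_mul_le_mul_left (le_trans (le_of_eq ?_) h) hEXp
    field_simp

end OperatorScaling

theorem mainTheorem2 (n : ℕ)
    (E : OperatorScaling.M n →ₚ[ℂ] OperatorScaling.M n) :
    OperatorScaling.IsApproxScalable E ↔ OperatorScaling.IsRankNonDecreasing E :=
  ⟨OperatorScaling.isRankNonDecreasing_of_isApproxScalable,
    OperatorScaling.isApproxScalable_of_isRankNonDecreasing⟩
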